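/- Let $n\ge 0$, let $B=\{z\in\mathbb R^{n+1}:|z|\le 1\}$ be the closed unit ball with interior $B^\circ$, and let $\mathrm{dist}_0\ge 0$ be the hyperbolic distance on $B^\circ$ (for the metric $4|dz|^2/(1-|z|^2)^2$), given by $$\cosh \mathrm{dist}_0(z,z')=1+\frac{2|z-z'|^2}{(1-|z|^2)(1-|z'|^2)} .$$ Let $\beta:B\times_0B=[B\times B;\partial\mathrm{Diag}]\to B\times B$ be the $0$-stretched product, i.e. the compact manifold with corners obtained by the (spherical, inward pointing) real blow-up of $\partial\mathrm{Diag}=\{(z,z):|z|=1\}$. Its boundary hypersurfaces are the front face $\beta^{-1}(\partial\mathrm{Diag})$, the left face, which is the closure of $\beta^{-1}(\partial B\times B^\circ)$, and the right face, which is the closure of $\beta^{-1}(B^\circ\times\partial B)$; its interior is $\beta^{-1}(B^\circ\times B^\circ)$, and the interior of the front face is the complement in it of the left and right faces. Let $\mathrm{Diag}_0$ be the lifted diagonal, the closure of $\beta^{-1}(\{(z,z):|z|<1\})$. Smoothness of functions on (open subsets of) $B\times_0B$ is $C^\infty$ smoothness up to all boundary faces. Then $\beta^*\mathrm{dist}_0$,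 defined on the interior of $B\times_0B$, has an extension to the union of the interior of $B\times_0 B$ and the interior of the front face which is smooth and positive on the complement of $\mathrm{Diag}_0$ in this union. Moreover, there are a defining function $\rho_L\in C^\infty(B\times_0B)$ of the left face (so $\rho_L\ge0$, $\rho_L$ vanishes exactly on the left face, and $d\rho_L\ne0$ there) and a function $F$ on $B\times_0B$ such that, with $\rho_R$ the reflection of $\rho_L$, i.e. its pull-back under the lift of $(z,z')\mapsto(z',z)$, $$\beta^*\mathrm{dist}_0=-\log(\rho_L\rho_R)+F$$ on that union (for the extended distance), where $$0<F\in C^\infty\big((B\times_0B)\setminus\mathrm{Diag}_0\big),\qquad F^2\in C^\infty(B\times_0B),$$ and $F^2$ is a quadratic defining function of $\mathrm{Diag}_0$: it is smooth and non-negative, it vanishes exactly on $\mathrm{Diag}_0$, and near each point of $\mathrm{Diag}_0$ it is bounded above and below by positive multiples of the square of the distance to $\mathrm{Diag}_0$ (equivalently, its differential vanishes on $\mathrm{Diag}_0$ and its Hessian is positive definite on the normal bundle of $\mathrm{Diag}_0$). -/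

import Mathlib

open scoped ContDiff

noncomputable section

/-- Euclidean space of dimension `n + 1`; the closed ball is its closed unit ball. -/
abbrev BallSpace (n : ℕ) : Type := EuclideanSpace ℝ (Fin (n + 1))

/-- The hyperbolic distance on the open unit ball, given by
`cosh (dist₀ (z, z')) = 1 + 2 |z - z'|² / ((1 - |z|²) (1 - |z'|²))`, `dist₀ ≥ 0`. -/
def hypDist {n : ℕ} (z z' : BallSpace n) : ℝ :=
  Real.arcosh (1 + 2 * ‖z - z'‖ ^ 2 / ((1 - ‖z‖ ^ 2) * (1 - ‖z'‖ ^ 2)))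

/-- The Euclidean space, with coordinates `(z, z', R, v, a, a')`, in which the stretched product
is realized. -/
abbrev StretchAmbient (n : ℕ) : Type :=
  BallSpace n × BallSpace n × ℝ × BallSpace n × ℝ × ℝ

/-- The `0`-stretched product `B ×₀ B = [B × B; ∂Diag]` of the closed unit ball `B`: the real
(spherical) blow-up of `∂Diag = {(z, z) : |z| = 1}` in `B × B`, in polar coordinates.
The functions `z - z'`, `1 - |z|²`, `1 - |z'|²` vanish exactly on `∂Diag` and their differentials
span its conormal bundle; `R` is the length and `(v, a, a')` the direction of the vector
`(z - z', 1 - |z|², 1 - |z'|²) = R (v, a, a')`.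
* Over a point of `(B × B) \ ∂Diag` this vector is non-zero, so there is exactly one point
  `(z, z', R, v, a, a')`, and `R > 0`.
* Over `(z, z) ∈ ∂Diag`, where `R = 0`, the fibre is the set of unit vectors `(v, a, a')` with
  `a, a' ≥ 0` and `a - a' = -2 ⟪v, z⟫`. These are the values `(w - w', -2 ⟪z, w⟫, -2 ⟪z, w'⟫)`,
  normalized, of the differentials on the inward pointing `(w, w')` modulo `T ∂Diag`, that is,
  the inward pointing unit sphere of the normal space of `∂Diag`. (For `R > 0` the relation
  `a - a' = -⟪v, z + z'⟫` follows from the other equations.) -/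
def stretchedProductSet (n : ℕ) : Set (StretchAmbient n) :=
  {p | match p with
    | (z, z', R, v, a, a') =>
      z - z' = R • v ∧ 1 - ‖z‖ ^ 2 = R * a ∧ 1 - ‖z'‖ ^ 2 = R * a' ∧
      a - a' = -inner ℝ v (z + z') ∧
      ‖v‖ ^ 2 + a ^ 2 + a' ^ 2 = 1 ∧
      0 ≤ R ∧ 0 ≤ a ∧ 0 ≤ a'}

/-- The `0`-stretched product as a (compact) space, with the topology of the ambient space. -/
abbrev StretchedProduct (n : ℕ) : Type := ↥(stretchedProductSet n)

namespace StretchedProduct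

variable {n : ℕ}

/-- The blow-down map `β : B ×₀ B → B × B`. -/
def blowDown (p : StretchedProduct n) : BallSpace n × BallSpace n := (p.1.1, p.1.2.1)

/-- The reflection, the lift to `B ×₀ B` of the exchange `(z, z') ↦ (z', z)` of the factors. -/
def reflect (p : StretchedProduct n) : StretchedProduct n :=
  ⟨match p.1 with
    | (z, z', R, v, a, a') => (z', z, R, -v, a', a), by
    obtain ⟨⟨z, z', R, v, a, a'⟩, h1, h2, h3, h4, h5, h6, h7, h8⟩ := p
    refine ⟨?_, h3, h2, ?_, ?_, h6, h8, h7⟩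
    · rw [smul_neg, ← h1, neg_sub]
    · rw [inner_neg_left, add_comm z' z]; linarith
    · rw [norm_neg]; linarith⟩

/-- The interior of `B ×₀ B`, the preimage of the product of the open balls. -/
def interiorPart (n : ℕ) : Set (StretchedProduct n) :=
  {p | ‖(blowDown p).1‖ < 1 ∧ ‖(blowDown p).2‖ < 1}

/-- The left boundary hypersurface: the lift of `∂B × B`, i.e. the closure of the preimage of
`∂B × B` without the corner `∂B × ∂B`. -/
def leftFace (n : ℕ) : Set (StretchedProduct n) :=
  closure {p | ‖(blowDown p).1‖ = 1 ∧ ‖(blowDown p).2‖ < 1}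

/-- The right boundary hypersurface: the lift of `B × ∂B`. -/
def rightFace (n : ℕ) : Set (StretchedProduct n) :=
  closure {p | ‖(blowDown p).1‖ < 1 ∧ ‖(blowDown p).2‖ = 1}

/-- The front face: the preimage of `∂Diag`. -/
def frontFace (n : ℕ) : Set (StretchedProduct n) :=
  {p | (blowDown p).1 = (blowDown p).2 ∧ ‖(blowDown p).1‖ = 1}

/-- The interior of the front face: the complement in it of the other two boundary faces. -/
def frontFaceInterior (n : ℕ) : Set (StretchedProduct n) :=
  frontFace n \ (leftFace n ∪ rightFace n)

/-- The lifted diagonal `Diag₀`: the closure of the preimage of the interior of the diagonal. -/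
def liftedDiagonal (n : ℕ) : Set (StretchedProduct n) :=
  closure {p | (blowDown p).1 = (blowDown p).2 ∧ ‖(blowDown p).1‖ < 1}

/-- Smoothness (up to all boundary faces) of a function on a relatively open subset `S` of
`B ×₀ B`: locally it is a `C^∞` function of the smooth functions `z, z'` on `B × B` and the polar
coordinates `R, (v, a, a')` of the blow-up. The `C^∞` structure of the blow-up is the one
generated by these functions; they embed it as a submanifold with corners of the ambient space. -/
def SmoothOn (u : StretchedProduct n → ℝ) (S : Set (StretchedProduct n)) : Prop :=
  ∀ p ∈ S, ∃ (U : Set (StretchAmbient n)) (g : StretchAmbient n → ℝ),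
    IsOpen U ∧ (p : StretchAmbient n) ∈ U ∧ ContDiffOn ℝ ∞ g U ∧
      ∀ q ∈ S, (q : StretchAmbient n) ∈ U → u q = g q

/-- `ρ` is a (boundary) defining function of the boundary hypersurface `H`: it is smooth and
non-negative, `H = {ρ = 0}`, and `dρ ≠ 0` at every point of `H`; the last condition is expressed
through the derivative of `ρ` along some smooth curve in `B ×₀ B` that starts at the point. -/
def IsDefiningFunction (ρ : StretchedProduct n → ℝ) (H : Set (StretchedProduct n)) : Prop :=
  SmoothOn ρ Set.univ ∧ (∀ p, 0 ≤ ρ p) ∧ (∀ p, ρ p = 0 ↔ p ∈ H) ∧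
  ∀ p ∈ H, ∃ (γ : ℝ → StretchedProduct n) (ε : ℝ), 0 < ε ∧ γ 0 = p ∧
    ContDiffOn ℝ ∞ (fun t => (γ t : StretchAmbient n)) (Set.Ico 0 ε) ∧
    derivWithin (fun t => ρ (γ t)) (Set.Ico 0 ε) 0 ≠ 0

/-- `g` is a quadratic defining function of the submanifold `S`: it is smooth and non-negative,
`S = {g = 0}`, and it vanishes exactly quadratically at `S`, i.e. near each point of `S` it is
bounded above and below by positive multiples of the square of the distance to `S`. For smooth
`g` this says that `dg = 0` on `S` and that the Hessian is positive definite on the normal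
bundle of `S`. -/
def IsQuadraticDefiningFunction (g : StretchedProduct n → ℝ) (S : Set (StretchedProduct n)) :
    Prop :=
  SmoothOn g Set.univ ∧ (∀ p, 0 ≤ g p) ∧ (∀ p, g p = 0 ↔ p ∈ S) ∧
  ∀ p ∈ S, ∃ c C : ℝ, 0 < c ∧ 0 < C ∧
    ∀ᶠ q in nhds p, c * Metric.infDist q S ^ 2 ≤ g q ∧ g q ≤ C * Metric.infDist q S ^ 2

end StretchedProduct

end

/-! Write `s = |v|²` and `q = a a'`. In polar coordinates `R²` cancels from the quotient defining
the distance, which becomes `arcosh (1 + 2s/q) = 2 log E - log q` with `E = √s + √(s + q)`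
(`arcosh_eq_log_sub_log`). This no longer involves `R`, so it extends to the interior of the front
face. The left face, right face and `Diag₀` are `a = 0`, `a' = 0` and `v = 0`. The relation `a - a'
= -⟪v, z + z'⟫` gives `2q ≥ 1 - 5s` (`le_coordProd`), so `s + q > 0` everywhere and `log E` is
smooth off `Diag₀`, even at the side faces.

Taking `ρ_L = a` would leave the remainder `2 log E`, which is `log (1/2)` on `Diag₀`. Instead `ρ_L
= a / √m(q)` and `F = 2 log E - log m(q)`, where `m(q) = q` near `Diag₀` and `m` is a small constant
for small `q`. Off `Diag₀` one has `m(q) < s + q ≤ E²`, so `F > 0` (`modifiedProd_lt_expHalf_sq`).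
Near `Diag₀`, `F = arcosh (1 + 2s/q)`, whose square is an analytic function of `s/q`
(`exists_analyticAt_eq_arcosh_sq`) comparable to `s`, hence to the squared distance to `Diag₀`. -/

open Filter Topology

/-! ### Real analysis of `arcosh` and its square -/

noncomputable section

/-- The entire function `w ↦ ∑ wᵏ / (2k)!`, which is `cosh (√w)` for `w ≥ 0`. -/
def coshSqrt (w : ℝ) : ℝ := FormalMultilinearSeries.ofScalarsSum (E := ℝ)
  (fun k : ℕ => (((2 * k).factorial : ℝ))⁻¹) w

theorem coshSqrt_hasFPowerSeries :
    HasFPowerSeriesOnBall coshSqrt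
      (FormalMultilinearSeries.ofScalars ℝ (fun k : ℕ => (((2 * k).factorial : ℝ))⁻¹)) 0 ⊤ := by
  have h : (FormalMultilinearSeries.ofScalars ℝ
      (fun k : ℕ => (((2 * k).factorial : ℝ))⁻¹)).radius = ⊤ := by
    apply FormalMultilinearSeries.ofScalars_radius_eq_top_of_tendsto
    · exact Eventually.of_forall fun k => by positivity
    · have h0 : Tendsto (fun k : ℕ => 1 / ((k : ℝ) + 1)) atTop (𝓝 0) :=
        tendsto_one_div_add_atTop_nhds_zero_nat
      refine squeeze_zero (fun k => by positivity) (fun k => ?_) h0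
      have h2 : ((2 * (k + 1)).factorial : ℝ)
          = (2 * k + 2) * ((2 * k + 1) * ((2 * k).factorial : ℝ)) := by
        rw [show 2 * (k + 1) = (2 * k + 1) + 1 by ring, Nat.factorial_succ, Nat.factorial_succ]
        push_cast; ring
      have h3 : (0 : ℝ) < ((2 * k).factorial : ℝ) := by positivity
      rw [Nat.succ_eq_add_one, h2, norm_inv, norm_inv, Real.norm_of_nonneg (by positivity),
        Real.norm_of_nonneg (by positivity), div_inv_eq_mul, inv_mul_eq_div,
        div_le_div_iff₀ (by positivity) (by positivity)]
      have : (0 : ℝ) ≤ k := by positivity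
      nlinarith [mul_nonneg this h3.le, mul_nonneg (mul_nonneg this this) h3.le]
  have := (FormalMultilinearSeries.ofScalars ℝ
      (fun k : ℕ => (((2 * k).factorial : ℝ))⁻¹)).hasFPowerSeriesOnBall (by rw [h]; simp)
  rwa [h] at this

theorem coshSqrt_sq (y : ℝ) : coshSqrt (y ^ 2) = Real.cosh y := by
  rw [coshSqrt, FormalMultilinearSeries.ofScalarsSum_eq_tsum]
  refine (tsum_congr fun k => ?_).trans (Real.hasSum_cosh y).tsum_eq
  rw [smul_eq_mul, ← pow_mul]; ring

theorem coshSqrt_contDiffAt (w : ℝ) : ContDiffAt ℝ ω coshSqrt w :=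
  (coshSqrt_hasFPowerSeries.analyticAt_of_mem (by simp)).contDiffAt

theorem coshSqrt_hasDerivAt_zero : HasDerivAt coshSqrt (1 / 2) 0 := by
  have h := coshSqrt_hasFPowerSeries.hasFPowerSeriesAt.hasDerivAt
  simpa [FormalMultilinearSeries.ofScalars, Nat.factorial] using h

/-- `arcosh (1 + 2x)²`, defined for `x ≥ 0`, extends analytically across `x = 0`. -/
theorem exists_analyticAt_eq_arcosh_sq :
    ∃ G : ℝ → ℝ, AnalyticAt ℝ G 0 ∧
      ∀ᶠ x in 𝓝 (0 : ℝ), 0 ≤ x → Real.arcosh (1 + 2 * x) ^ 2 = G x := by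
  -- `coshSqrt` has derivative `1/2 ≠ 0` at `0`, so it has an analytic local inverse at `coshSqrt 0
  -- = 1`; `G x` is this inverse at `1 + 2x`.
  have hd : HasFDerivAt coshSqrt
      ((ContinuousLinearEquiv.unitsEquivAut ℝ (Units.mk0 (1 / 2 : ℝ) (by norm_num)) :
        ℝ ≃L[ℝ] ℝ) : ℝ →L[ℝ] ℝ) 0 := by
    refine coshSqrt_hasDerivAt_zero.hasFDerivAt.congr_fderiv ?_
    ext; simp
  have h0 : coshSqrt 0 = 1 := by simpa using coshSqrt_sq 0
  have hc := coshSqrt_contDiffAt 0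
  have hn : (ω : WithTop ℕ∞) ≠ 0 := by simp
  have hG := hc.to_localInverse hd hn
  have hl := (hc.hasStrictFDerivAt' hd hn).eventually_left_inverse
  refine ⟨fun x => hc.localInverse hd hn (1 + 2 * x), ?_, ?_⟩
  · rw [h0] at hG
    refine ContDiffAt.analyticAt (ContDiffAt.comp (0 : ℝ) ?_ (by fun_prop))
    rwa [mul_zero, add_zero]
  · have ht : Tendsto (fun x : ℝ => 2 * Real.sqrt x) (𝓝 0) (𝓝 0) := by
      have : Continuous (fun x : ℝ => 2 * Real.sqrt x) := by fun_prop
      simpa using this.tendsto 0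
    have ht2 : Tendsto (fun x : ℝ => (2 * Real.arsinh (Real.sqrt x)) ^ 2) (𝓝 0) (𝓝 0) := by
      have : Continuous (fun x : ℝ => (2 * Real.arsinh (Real.sqrt x)) ^ 2) := by
        have := Real.continuous_arsinh
        fun_prop
      simpa using this.tendsto 0
    -- `y = 2 arsinh √x` satisfies `cosh y = 1 + 2x`, and `y²` is close to `0`, where the local
    -- inverse undoes `coshSqrt`.
    filter_upwards [ht2.eventually hl] with x hx hx0
    have h1 : Real.cosh (2 * Real.arsinh (Real.sqrt x)) = 1 + 2 * x := by
      rw [Real.cosh_two_mul, Real.cosh_sq, Real.sinh_arsinh, Real.sq_sqrt hx0]; ring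
    have h2 : Real.arcosh (1 + 2 * x) = 2 * Real.arsinh (Real.sqrt x) := by
      rw [← h1, Real.arcosh_cosh]
      have := Real.arsinh_nonneg_iff.2 (Real.sqrt_nonneg x)
      positivity
    rw [coshSqrt_sq, h1] at hx
    rw [h2]
    exact hx.symm

/-- With `y = arcosh (1 + 2x)`, the half-angle formula reads `x = sinh² (y/2)`, and `sinh t ≥ t` for
`t ≥ 0`. -/
theorem arcosh_sq_le {x : ℝ} (hx : 0 ≤ x) : Real.arcosh (1 + 2 * x) ^ 2 ≤ 4 * x := by
  have h := Real.cosh_arcosh (show 1 ≤ 1 + 2 * x by linarith)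
  have h0 := Real.arcosh_nonneg (show 1 ≤ 1 + 2 * x by linarith)
  have h2 := Real.cosh_two_mul (Real.arcosh (1 + 2 * x) / 2)
  have h3 : Real.arcosh (1 + 2 * x) / 2 ≤ Real.sinh (Real.arcosh (1 + 2 * x) / 2) :=
    Real.self_le_sinh_iff.2 (by linarith)
  rw [mul_div_cancel₀ _ two_ne_zero, Real.cosh_sq, h] at h2
  nlinarith

/-- Combines `cosh y ≤ exp (y²/2)` with `|exp u - 1| ≤ 2|u|` for `|u| ≤ 1`. For `u = y²/2 ≤ 2x`, the
assumption `x ≤ 1/2` gives `u ≤ 1`. -/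
theorem le_arcosh_sq {x : ℝ} (hx : 0 ≤ x) (hx1 : x ≤ 1 / 2) :
    2 * x ≤ Real.arcosh (1 + 2 * x) ^ 2 := by
  have h := Real.cosh_arcosh (show 1 ≤ 1 + 2 * x by linarith)
  have h1 := Real.cosh_le_exp_half_sq (Real.arcosh (1 + 2 * x))
  have h2 := arcosh_sq_le hx
  set y := Real.arcosh (1 + 2 * x)
  have h3 := Real.abs_exp_sub_one_le (x := y ^ 2 / 2) (by
    rw [abs_of_nonneg] <;> [linarith; positivity])
  rw [abs_of_nonneg (by positivity : 0 ≤ y ^ 2 / 2)] at h3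
  have := (abs_le.1 h3).2
  linarith

/-- The argument of the logarithm in `arcosh` is the perfect square `(√s + √(s + q))²` divided by
`q`. -/
theorem arcosh_eq_log_sub_log {s q : ℝ} (hs : 0 ≤ s) (hq : 0 < q) :
    Real.arcosh (1 + 2 * (s / q)) =
      2 * Real.log (Real.sqrt s + Real.sqrt (s + q)) - Real.log q := by
  have hE : 0 < Real.sqrt s + Real.sqrt (s + q) := by positivity
  have h1 : Real.sqrt ((1 + 2 * (s / q)) ^ 2 - 1) = 2 * (Real.sqrt s * Real.sqrt (s + q)) / q := by
    rw [show (1 + 2 * (s / q)) ^ 2 - 1 = (2 / q) ^ 2 * (s * (s + q)) by field_simp; ring,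
      Real.sqrt_mul (by positivity), Real.sqrt_sq (by positivity), Real.sqrt_mul hs]
    ring
  rw [Real.arcosh, h1, two_mul (Real.log _), ← Real.log_mul hE.ne' hE.ne',
    ← Real.log_div (by positivity) hq.ne']
  congr 1
  have h2 := Real.mul_self_sqrt hs
  have h3 := Real.mul_self_sqrt (show 0 ≤ s + q by positivity)
  field_simp
  linear_combination - h2 - h3

end

noncomputable section

namespace StretchedProduct

variable {n : ℕ}

/-! ### Coordinates -/

/-- The coordinate `a` of the ambient space, vanishing on the left face. -/
def coordL (x : StretchAmbient n) : ℝ := x.2.2.2.2.1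

/-- The coordinate `a'` of the ambient space, vanishing on the right face. -/
def coordR (x : StretchAmbient n) : ℝ := x.2.2.2.2.2

/-- The function `|v|²` on the ambient space, vanishing on the lifted diagonal. -/
def dirSq (x : StretchAmbient n) : ℝ := ‖x.2.2.2.1‖ ^ 2

/-- The product `a a'`. -/
def coordProd (x : StretchAmbient n) : ℝ := coordL x * coordR x

@[fun_prop]
theorem contDiff_coordL : ContDiff ℝ ∞ (coordL (n := n)) := by
  unfold coordL; fun_prop

@[fun_prop]
theorem contDiff_coordR : ContDiff ℝ ∞ (coordR (n := n)) := by
  unfold coordR; fun_prop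

@[fun_prop]
theorem contDiff_dirSq : ContDiff ℝ ∞ (dirSq (n := n)) := by
  unfold dirSq
  exact ContDiff.norm_sq ℝ (by fun_prop)

@[fun_prop]
theorem contDiff_coordProd : ContDiff ℝ ∞ (coordProd (n := n)) := by
  unfold coordProd; fun_prop

theorem dirSq_nonneg (x : StretchAmbient n) : 0 ≤ dirSq x := by unfold dirSq; positivity

theorem coordL_nonneg (p : StretchedProduct n) : 0 ≤ coordL p.1 := by
  obtain ⟨⟨z, z', R, v, a, a'⟩, h1, h2, h3, h4, h5, h6, h7, h8⟩ := p
  exact h7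

theorem coordR_nonneg (p : StretchedProduct n) : 0 ≤ coordR p.1 := by
  obtain ⟨⟨z, z', R, v, a, a'⟩, h1, h2, h3, h4, h5, h6, h7, h8⟩ := p
  exact h8

theorem coordProd_nonneg (p : StretchedProduct n) : 0 ≤ coordProd p.1 :=
  mul_nonneg (coordL_nonneg p) (coordR_nonneg p)

theorem dirSq_add (p : StretchedProduct n) :
    dirSq p.1 + coordL p.1 ^ 2 + coordR p.1 ^ 2 = 1 := by
  obtain ⟨⟨z, z', R, v, a, a'⟩, h1, h2, h3, h4, h5, h6, h7, h8⟩ := p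
  exact h5

theorem norm_fst_le (p : StretchedProduct n) : ‖(blowDown p).1‖ ≤ 1 := by
  obtain ⟨⟨z, z', R, v, a, a'⟩, h1, h2, h3, h4, h5, h6, h7, h8⟩ := p
  have : 0 ≤ R * a := mul_nonneg h6 h7
  change ‖z‖ ≤ 1
  nlinarith [norm_nonneg z]

theorem norm_snd_le (p : StretchedProduct n) : ‖(blowDown p).2‖ ≤ 1 := by
  obtain ⟨⟨z, z', R, v, a, a'⟩, h1, h2, h3, h4, h5, h6, h7, h8⟩ := p
  have : 0 ≤ R * a' := mul_nonneg h6 h8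
  change ‖z'‖ ≤ 1
  nlinarith [norm_nonneg z']

theorem abs_coordL_sub_coordR_le (p : StretchedProduct n) :
    |coordL p.1 - coordR p.1| ≤ 2 * Real.sqrt (dirSq p.1) := by
  have hz := norm_fst_le p
  have hz' := norm_snd_le p
  obtain ⟨⟨z, z', R, v, a, a'⟩, h1, h2, h3, h4, h5, h6, h7, h8⟩ := p
  change |a - a'| ≤ 2 * Real.sqrt (‖v‖ ^ 2)
  rw [h4, abs_neg, Real.sqrt_sq (norm_nonneg v)]
  have h := abs_real_inner_le_norm v (z + z')
  have h2 : ‖z + z'‖ ≤ 2 := (norm_add_le _ _).trans (by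
    linarith [show ‖z‖ ≤ 1 from hz, show ‖z'‖ ≤ 1 from hz'])
  nlinarith [norm_nonneg v]

/-- `2aa' = a² + a'² - (a - a')²`, where `a² + a'² = 1 - s` and `(a - a')² ≤ 4s`. -/
theorem le_coordProd (p : StretchedProduct n) : (1 - 5 * dirSq p.1) / 2 ≤ coordProd p.1 := by
  have h := sq_le_sq.2 ((abs_coordL_sub_coordR_le p).trans (le_abs_self _))
  rw [mul_pow, Real.sq_sqrt (dirSq_nonneg _)] at h
  have := dirSq_add p
  unfold coordProd
  linarith

theorem coordProd_le (p : StretchedProduct n) : coordProd p.1 ≤ (1 - dirSq p.1) / 2 := by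
  have := dirSq_add p
  unfold coordProd
  nlinarith [sq_nonneg (coordL p.1 - coordR p.1)]

theorem dirSq_add_coordProd_pos (p : StretchedProduct n) : 0 < dirSq p.1 + coordProd p.1 := by
  have h1 := le_coordProd p
  have h2 := coordProd_nonneg p
  have h3 := dirSq_nonneg p.1
  rcases h3.lt_or_eq with h | h <;> linarith

/-! ### Polar coordinates and curves -/

/-- The squared length of the last three coordinates. -/
def lengthSq (x : StretchAmbient n) : ℝ :=
  ‖x.2.2.2.1‖ ^ 2 + x.2.2.2.2.1 ^ 2 + x.2.2.2.2.2 ^ 2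

/-- The rescaling of the last three coordinates to a unit vector, compensated by `R`. -/
def normalize (x : StretchAmbient n) : StretchAmbient n :=
  let N := Real.sqrt (lengthSq x)
  (x.1, x.2.1, x.2.2.1 * N, N⁻¹ • x.2.2.2.1, N⁻¹ * x.2.2.2.2.1, N⁻¹ * x.2.2.2.2.2)

/-- Every relation except unit length survives scaling `(v, a, a')` by `N⁻¹` and `R` by `N`, so
curves can be written down without normalizing. -/
theorem normalize_mem {x : StretchAmbient n} (h1 : x.1 - x.2.1 = x.2.2.1 • x.2.2.2.1)
    (h2 : 1 - ‖x.1‖ ^ 2 = x.2.2.1 * x.2.2.2.2.1) (h3 : 1 - ‖x.2.1‖ ^ 2 = x.2.2.1 * x.2.2.2.2.2)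
    (h4 : x.2.2.2.2.1 - x.2.2.2.2.2 = -inner ℝ x.2.2.2.1 (x.1 + x.2.1))
    (h6 : 0 ≤ x.2.2.1) (h7 : 0 ≤ x.2.2.2.2.1) (h8 : 0 ≤ x.2.2.2.2.2)
    (hN : 0 < lengthSq x) : normalize x ∈ stretchedProductSet n := by
  obtain ⟨z, z', R, v, a, a'⟩ := x
  have hs := Real.sq_sqrt hN.le
  have hp := Real.sqrt_pos.2 hN
  dsimp only [normalize, lengthSq] at *
  set N := Real.sqrt (‖v‖ ^ 2 + a ^ 2 + a' ^ 2)
  refine ⟨?_, ?_, ?_, ?_, ?_, by positivity, by positivity, by positivity⟩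
  · rw [h1, smul_smul, mul_assoc, mul_inv_cancel₀ hp.ne', mul_one]
  · rw [h2]; field_simp
  · rw [h3]; field_simp
  · rw [real_inner_smul_left, ← mul_sub, h4]; ring
  · rw [norm_smul, mul_pow, mul_pow, mul_pow, norm_inv, Real.norm_of_nonneg hp.le, ← mul_add,
      ← mul_add, ← hs]
    field_simp

theorem contDiffAt_sqrt_lengthSq {x : StretchAmbient n} (hN : 0 < lengthSq x) :
    ContDiffAt ℝ ∞ (fun x : StretchAmbient n => Real.sqrt (lengthSq x)) x := by
  refine ContDiffAt.sqrt ?_ hN.ne'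
  unfold lengthSq
  exact ((ContDiff.norm_sq ℝ (by fun_prop)).add (by fun_prop)).add (by fun_prop)
    |>.contDiffAt

theorem contDiffAt_normalize {x : StretchAmbient n} (hN : 0 < lengthSq x) :
    ContDiffAt ℝ ∞ normalize x := by
  have h := contDiffAt_sqrt_lengthSq hN
  have hi := h.inv (Real.sqrt_pos.2 hN).ne'
  exact ContDiffAt.prodMk (by fun_prop) (ContDiffAt.prodMk (by fun_prop)
    (ContDiffAt.prodMk (ContDiffAt.mul (by fun_prop) h)
      (ContDiffAt.prodMk (hi.smul (by fun_prop))
        (ContDiffAt.prodMk (hi.mul (by fun_prop)) (hi.mul (by fun_prop))))))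

theorem lengthSq_eq_one (p : StretchedProduct n) : lengthSq p.1 = 1 := dirSq_add p

theorem normalize_eq_self (p : StretchedProduct n) : normalize p.1 = p.1 := by
  simp [normalize, lengthSq_eq_one p]

theorem mem_closure_of_curve {S : Set (StretchedProduct n)} (p : StretchedProduct n)
    (c : ℝ → StretchAmbient n) (hc : ContinuousAt c 0) (h0 : c 0 = p.1)
    (h : ∀ᶠ t in 𝓝[>] (0 : ℝ), ∃ hm : normalize (c t) ∈ stretchedProductSet n, ⟨_, hm⟩ ∈ S) :
    p ∈ closure S := by
  rw [closure_subtype]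
  have hn : ContinuousAt normalize (c 0) := by
    rw [h0]
    exact (contDiffAt_normalize (by rw [lengthSq_eq_one]; norm_num)).continuousAt
  have ht : Tendsto (fun t => normalize (c t)) (𝓝[>] 0) (𝓝 p.1) := by
    have := (hn.comp hc).tendsto
    simp only [Function.comp, h0, normalize_eq_self] at this
    exact this.mono_left nhdsWithin_le_nhds
  refine mem_closure_of_tendsto ht (h.mono ?_)
  rintro t ⟨hm, ht⟩
  exact ⟨_, ht, rfl⟩

/-- The curve along which the first point moves radially inwards, before normalization. -/
def inwardCurve (x : StretchAmbient n) (t : ℝ) : StretchAmbient n :=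
  -- The speed is proportional to `R`, so at `R = 0` only the direction moves. If `|z| = 1`, then `1
  -- - (1 - Rt)²|z|² = R(2t - Rt²)`, which dictates the new `a`.
  ((1 - x.2.2.1 * t) • x.1, x.2.1, x.2.2.1, x.2.2.2.1 - t • x.1, 2 * t - x.2.2.1 * t ^ 2,
    x.2.2.2.2.2)

theorem contDiff_inwardCurve (x : StretchAmbient n) : ContDiff ℝ ∞ (inwardCurve x) := by
  unfold inwardCurve; fun_prop

theorem inwardCurve_zero {p : StretchedProduct n} (hp : coordL p.1 = 0) :
    inwardCurve p.1 0 = p.1 := by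
  obtain ⟨⟨z, z', R, v, a, a'⟩, h⟩ := p
  simp only [coordL] at hp
  simp [inwardCurve, hp]

theorem lengthSq_inwardCurve_pos {p : StretchedProduct n} (hp : coordL p.1 = 0) {t : ℝ}
    (ht : 0 ≤ t) (hRt : p.1.2.2.1 * t < 1) : 0 < lengthSq (inwardCurve p.1 t) := by
  rcases ht.eq_or_lt with rfl | ht
  · rw [inwardCurve_zero hp, lengthSq_eq_one]; norm_num
  · have : 0 < 2 * t - p.1.2.2.1 * t ^ 2 := by nlinarith
    unfold lengthSq inwardCurve
    positivity

theorem normalize_inwardCurve_mem {p : StretchedProduct n} (hp : coordL p.1 = 0) {t : ℝ}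
    (ht : 0 ≤ t) (hRt : p.1.2.2.1 * t < 1) :
    normalize (inwardCurve p.1 t) ∈ stretchedProductSet n := by
  have hN := lengthSq_inwardCurve_pos hp ht hRt
  obtain ⟨⟨z, z', R, v, a, a'⟩, h1, h2, h3, h4, h5, h6, h7, h8⟩ := p
  obtain rfl : a = 0 := hp
  have hz : ‖z‖ ^ 2 = 1 := by linarith
  obtain rfl : z' = z - R • v := by rw [← h1]; abel
  have hzz : inner ℝ z z = (1 : ℝ) := by rw [real_inner_self_eq_norm_sq, hz]
  dsimp only at hRt
  refine normalize_mem ?_ ?_ h3 ?_ h6 ?_ h8 hN <;> dsimp only [inwardCurve]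
  · module
  · rw [norm_smul, mul_pow, hz, Real.norm_eq_abs, sq_abs]; ring
  · have h9 : a' = inner ℝ v (z + (z - R • v)) := by linarith
    rw [h9]
    simp only [inner_add_right, inner_sub_right, inner_sub_left, real_inner_smul_left,
      real_inner_smul_right, real_inner_comm z v, hzz]
    ring
  · nlinarith

/-! ### The boundary faces and the lifted diagonal -/

theorem continuous_reflect : Continuous (reflect (n := n)) := by
  refine Continuous.subtype_mk (f := fun p : StretchedProduct n =>
    (p.1.2.1, p.1.1, p.1.2.2.1, -p.1.2.2.2.1, p.1.2.2.2.2.2, p.1.2.2.2.2.1)) (by fun_prop) _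

theorem reflect_reflect (p : StretchedProduct n) : reflect (reflect p) = p := by
  apply Subtype.ext
  simp [reflect]

theorem coordL_reflect (p : StretchedProduct n) : coordL (reflect p).1 = coordR p.1 := rfl

/-- If `a > 0` and `R > 0`, the point already lies over `B° × ∂B`. If `a > 0` and `R = 0`, it is
approached by such points; if `a = 0`, it is approached by points with `a > 0`. -/
theorem mem_rightFace_of_coordR_eq_zero {p : StretchedProduct n} (hp : coordR p.1 = 0) :
    p ∈ rightFace n := by
  have key : ∀ p : StretchedProduct n, coordR p.1 = 0 → 0 < coordL p.1 → p ∈ rightFace n := by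
    intro p hp hp'
    obtain ⟨⟨z, z', R, v, a, a'⟩, h⟩ := p
    have hm := h
    obtain ⟨h1, h2, h3, h4, h5, h6, h7, h8⟩ := h
    obtain rfl : a' = 0 := hp
    replace hp' : 0 < a := hp'
    have hz' : ‖z'‖ ^ 2 = 1 := by linarith
    have hz1 : ‖z'‖ = 1 := by
      rwa [pow_eq_one_iff_of_nonneg (norm_nonneg _) two_ne_zero] at hz'
    rcases h6.eq_or_lt with rfl | hR
    · obtain rfl : z = z' := by rwa [zero_smul, sub_eq_zero] at h1
      have ha : a = -(2 * inner ℝ z v) := by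
        rw [inner_add_right, real_inner_comm] at h4; linarith
      -- Leaves the front face in the direction `v` with `R = t`; since `a = -2⟪z, v⟫`, `1 - |z +
      -- tv|² = t(a - t|v|²)`.
      refine mem_closure_of_curve _ (fun t => (z + t • v, z, t, v, a - t * ‖v‖ ^ 2, 0))
        (by fun_prop) (by simp) ?_
      have hev : ∀ᶠ t in 𝓝[>] (0 : ℝ), 0 < a - t * ‖v‖ ^ 2 := by
        refine eventually_nhdsWithin_of_eventually_nhds ?_
        have : Continuous fun t : ℝ => a - t * ‖v‖ ^ 2 := by fun_prop
        exact this.continuousAt.eventually (lt_mem_nhds (by simpa using hp'))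
      filter_upwards [hev, self_mem_nhdsWithin] with t ht ht0
      replace ht0 : 0 < t := ht0
      have h2' : 1 - ‖z + t • v‖ ^ 2 = t * (a - t * ‖v‖ ^ 2) := by
        rw [norm_add_sq_real, norm_smul, real_inner_smul_right, hz', ha, mul_pow,
          Real.norm_eq_abs, sq_abs]
        ring
      refine ⟨normalize_mem ?_ ?_ ?_ ?_ ht0.le ht.le le_rfl ?_, ?_, hz1⟩
      · simp
      · exact h2'
      · simpa using h3
      · dsimp only
        rw [inner_add_right, inner_add_right, real_inner_smul_right, real_inner_self_eq_norm_sq,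
          real_inner_comm, ha]
        ring
      · unfold lengthSq; dsimp only; positivity
      · change ‖z + t • v‖ < 1
        have : 0 < t * (a - t * ‖v‖ ^ 2) := by positivity
        nlinarith [norm_nonneg (z + t • v)]
    · refine subset_closure ⟨?_, hz1⟩
      change ‖z‖ < 1
      have : 0 < R * a := by positivity
      nlinarith [norm_nonneg z]
  rcases (coordL_nonneg p).eq_or_lt with h | h
  · rw [rightFace, ← closure_closure]
    refine mem_closure_of_curve p (inwardCurve p.1) (contDiff_inwardCurve _).continuous.continuousAt
      (inwardCurve_zero h.symm) ?_
    have hev : ∀ᶠ t in 𝓝[>] (0 : ℝ), p.1.2.2.1 * t < 1 := by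
      refine eventually_nhdsWithin_of_eventually_nhds ?_
      have : Continuous fun t : ℝ => p.1.2.2.1 * t := by fun_prop
      exact this.continuousAt.eventually (gt_mem_nhds (by simp))
    filter_upwards [hev, self_mem_nhdsWithin] with t ht ht0
    replace ht0 : 0 < t := ht0
    have hN := Real.sqrt_pos.2 (lengthSq_inwardCurve_pos h.symm ht0.le ht)
    refine ⟨normalize_inwardCurve_mem h.symm ht0.le ht, key _ ?_ ?_⟩
    · change _ * coordR p.1 = 0
      rw [hp, mul_zero]
    · refine mul_pos (inv_pos.2 hN) (?_ : 0 < 2 * t - p.1.2.2.1 * t ^ 2)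
      nlinarith
  · exact key p hp h

theorem mem_leftFace_iff {p : StretchedProduct n} : p ∈ leftFace n ↔ coordL p.1 = 0 := by
  constructor
  · intro hp
    have hsub : leftFace n ⊆ {p | coordL p.1 = 0} := closure_minimal ?_ ?_
    · exact hsub hp
    · rintro ⟨⟨z, z', R, v, a, a'⟩, h1, h2, h3, h4, h5, h6, h7, h8⟩ ⟨hz, hz'⟩
      change ‖z‖ = 1 at hz
      change ‖z'‖ < 1 at hz'
      have h9 : 0 < R * a' := by nlinarith [norm_nonneg z']
      have hR : R ≠ 0 := by rintro rfl; simp at h9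
      rw [hz] at h2
      exact (mul_eq_zero.1 (by linarith : R * a = 0)).resolve_left hR
    · exact isClosed_eq (contDiff_coordL.continuous.comp continuous_subtype_val) continuous_const
  · intro hp
    have h := mem_rightFace_of_coordR_eq_zero (p := reflect p) hp
    have h2 := mem_closure_image (continuous_reflect (n := n)).continuousAt h
    rw [reflect_reflect] at h2
    refine closure_mono ?_ h2
    rintro _ ⟨q, ⟨hq, hq'⟩, rfl⟩
    exact ⟨hq', hq⟩

theorem mem_liftedDiagonal_iff {p : StretchedProduct n} :
    p ∈ liftedDiagonal n ↔ dirSq p.1 = 0 := by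
  constructor
  · intro hp
    have hsub : liftedDiagonal n ⊆ {p | dirSq p.1 = 0} := closure_minimal ?_ ?_
    · exact hsub hp
    · rintro ⟨⟨z, z', R, v, a, a'⟩, h1, h2, h3, h4, h5, h6, h7, h8⟩ ⟨hz, hz'⟩
      change z = z' at hz
      change ‖z‖ < 1 at hz'
      have h9 : 0 < R * a := by nlinarith [norm_nonneg z]
      have hR : R ≠ 0 := by rintro rfl; simp at h9
      rw [hz, sub_self, eq_comm, smul_eq_zero] at h1
      simp [dirSq, h1.resolve_left hR]
    · exact isClosed_eq (contDiff_dirSq.continuous.comp continuous_subtype_val) continuous_const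
  · intro hp
    obtain ⟨⟨z, z', R, v, a, a'⟩, h⟩ := p
    have hm := h
    obtain ⟨h1, h2, h3, h4, h5, h6, h7, h8⟩ := h
    obtain rfl : v = 0 := by simpa [dirSq] using hp
    obtain rfl : z = z' := by rwa [smul_zero, sub_eq_zero] at h1
    obtain rfl : a = a' := by simpa [sub_eq_zero] using h4
    have ha : 0 < a := by
      refine h7.lt_of_ne ?_
      rintro rfl
      simp at h5
    have ha2 : a ^ 2 = 1 / 2 := by simp at h5; linarith
    -- Shrinks `z` radially inside the diagonal; dividing by `a > 0` recovers the matching `R`.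
    refine mem_closure_of_curve _
      (fun t => ((1 - t) • z, (1 - t) • z, (1 - ‖(1 - t) • z‖ ^ 2) / a, 0, a, a))
      (by fun_prop) (by simp [h2, ha.ne']) ?_
    filter_upwards [Ioo_mem_nhdsGT (zero_lt_one' ℝ)] with t ht
    have hz : ‖z‖ ≤ 1 := norm_fst_le ⟨_, hm⟩
    have hlt : ‖(1 - t) • z‖ < 1 := by
      rw [norm_smul, Real.norm_of_nonneg (by linarith [ht.2])]
      nlinarith [ht.1, ht.2, norm_nonneg z]
    have hlt2 : 0 < 1 - ‖(1 - t) • z‖ ^ 2 := by nlinarith [norm_nonneg ((1 - t) • z)]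
    refine ⟨normalize_mem ?_ ?_ ?_ ?_ ?_ ha.le ha.le ?_, rfl, hlt⟩
    · simp
    · dsimp only; field_simp
    · dsimp only; field_simp
    · simp
    · dsimp only; positivity
    · unfold lengthSq; dsimp only; positivity

theorem coord_pos {p : StretchedProduct n} (hp : p ∈ interiorPart n ∪ frontFaceInterior n) :
    0 < coordL p.1 ∧ 0 < coordR p.1 := by
  rcases hp with ⟨h, h'⟩ | ⟨-, h⟩
  · obtain ⟨⟨z, z', R, v, a, a'⟩, h1, h2, h3, h4, h5, h6, h7, h8⟩ := p
    change ‖z‖ < 1 at h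
    change ‖z'‖ < 1 at h'
    constructor
    · refine h7.lt_of_ne ?_
      rintro rfl
      nlinarith [norm_nonneg z]
    · refine h8.lt_of_ne ?_
      rintro rfl
      nlinarith [norm_nonneg z']
  · rw [Set.mem_union, not_or, mem_leftFace_iff] at h
    exact ⟨(coordL_nonneg p).lt_of_ne' h.1,
      (coordR_nonneg p).lt_of_ne' fun h0 => h.2 (mem_rightFace_of_coordR_eq_zero h0)⟩

/-! ### The distance to the lifted diagonal -/

/-- The comparison point keeps `z`, with direction `(0, 1/√2, 1/√2)`. The constant is `15 = 3 · 5`,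
from `R ≤ 3` and `|1 - √2 a| ≤ 5|v|`; distances are for the sup metric. -/
theorem exists_mem_liftedDiagonal_dist_le (q : StretchedProduct n) :
    ∃ d ∈ liftedDiagonal n, dist q d ≤ 15 * Real.sqrt (dirSq q.1) := by
  have hz := norm_fst_le q
  have hz' := norm_snd_le q
  have haa := abs_coordL_sub_coordR_le q
  obtain ⟨⟨z, z', R, v, a, a'⟩, h1, h2, h3, h4, h5, h6, h7, h8⟩ := q
  change ‖z‖ ≤ 1 at hz
  change ‖z'‖ ≤ 1 at hz'
  change |a - a'| ≤ 2 * Real.sqrt (‖v‖ ^ 2) at haa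
  change ∃ d ∈ liftedDiagonal n, dist _ d ≤ 15 * Real.sqrt (‖v‖ ^ 2)
  rw [Real.sqrt_sq (norm_nonneg v)] at *
  have hv := norm_nonneg v
  have hv1 : ‖v‖ ≤ 1 := by nlinarith
  have ha1 : a ≤ 1 := by nlinarith
  have ha1' : a' ≤ 1 := by nlinarith
  have hR : R ≤ 3 := by
    have hsq : R ^ 2 = ‖z - z'‖ ^ 2 + (1 - ‖z‖ ^ 2) ^ 2 + (1 - ‖z'‖ ^ 2) ^ 2 := by
      rw [h1, h2, h3, norm_smul, mul_pow, Real.norm_eq_abs, sq_abs]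
      linear_combination -R ^ 2 * h5
    have h9 : ‖z - z'‖ ≤ 2 := (norm_sub_le _ _).trans (by linarith)
    have h10 : (1 - ‖z‖ ^ 2) ^ 2 ≤ 1 := by
      rw [sq_le_one_iff_abs_le_one, abs_le]; constructor <;> nlinarith [norm_nonneg z]
    have h11 : (1 - ‖z'‖ ^ 2) ^ 2 ≤ 1 := by
      rw [sq_le_one_iff_abs_le_one, abs_le]; constructor <;> nlinarith [norm_nonneg z']
    nlinarith [norm_nonneg (z - z')]
  set r := Real.sqrt 2 with hr
  have hr2 : r ^ 2 = 2 := Real.sq_sqrt (by norm_num)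
  have hr0 : 0 < r := by positivity
  have hr1 : 1 ≤ r := by nlinarith
  have bound : ∀ b b' : ℝ, 0 ≤ b → b ≤ 1 → 0 ≤ b' → b' ≤ 1 → |b - b'| ≤ 2 * ‖v‖ →
      ‖v‖ ^ 2 + b ^ 2 + b' ^ 2 = 1 → |1 - r * b| ≤ 5 * ‖v‖ := by
    intro b b' hb hb1 hb' hb1' hbb h
    -- By unit length, `2b² - 1 = b² - b'² - |v|²`, which is at most `5|v|` in absolute value.
    have h9 : (r * b - 1) * (r * b + 1) = (b - b') * (b + b') - ‖v‖ ^ 2 := by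
      linear_combination b ^ 2 * hr2 + h
    have h10 : |r * b - 1| * (r * b + 1) ≤ 5 * ‖v‖ := by
      rw [← abs_of_nonneg (by positivity : 0 ≤ r * b + 1), ← abs_mul, h9]
      refine (abs_sub _ _).trans ?_
      rw [abs_mul, abs_of_nonneg (by positivity : 0 ≤ b + b'), abs_of_nonneg (sq_nonneg ‖v‖)]
      nlinarith [mul_le_mul_of_nonneg_left (by linarith : b + b' ≤ 2) (abs_nonneg (b - b'))]
    rw [abs_sub_comm]
    have : 0 ≤ |r * b - 1| * (r * b) := by positivity
    linarith
  have hb := bound a a' h7 ha1 h8 ha1' haa h5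
  have hb' := bound a' a h8 ha1' h7 ha1 (by rwa [abs_sub_comm]) (by linarith)
  have hinv : ∀ b : ℝ, |1 - r * b| ≤ 5 * ‖v‖ → |b - r⁻¹| ≤ 15 * ‖v‖ := by
    intro b h
    have : 1 - r * b = -(r * (b - r⁻¹)) := by field_simp; ring
    rw [this, abs_neg, abs_mul, abs_of_pos hr0] at h
    nlinarith [abs_nonneg (b - r⁻¹)]
  have hsum : r⁻¹ ^ 2 + r⁻¹ ^ 2 = 1 := by rw [inv_pow, hr2]; norm_num
  have hmem : (z, z, r * (1 - ‖z‖ ^ 2), 0, r⁻¹, r⁻¹) ∈ stretchedProductSet n := by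
    refine ⟨by simp, ?_, ?_, by simp, by simpa using hsum, ?_, by positivity, by positivity⟩
    · field_simp
    · field_simp
    · have : 0 ≤ 1 - ‖z‖ ^ 2 := by nlinarith [norm_nonneg z]
      positivity
  refine ⟨⟨_, hmem⟩, mem_liftedDiagonal_iff.2 (by simp [dirSq]), ?_⟩
  rw [Subtype.dist_eq]
  simp only [Prod.dist_eq, max_le_iff, dist_self]
  refine ⟨by positivity, ?_, ?_, ?_, ?_, ?_⟩
  · rw [dist_comm, dist_eq_norm, h1, norm_smul, Real.norm_of_nonneg h6]
    nlinarith
  · rw [Real.dist_eq, h2, show R - r * (R * a) = R * (1 - r * a) by ring, abs_mul,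
      abs_of_nonneg h6]
    calc R * |1 - r * a| ≤ 3 * (5 * ‖v‖) := mul_le_mul hR hb (abs_nonneg _) (by norm_num)
      _ = 15 * ‖v‖ := by ring
  · exact (dist_zero_right v).trans_le (by linarith)
  · exact (Real.dist_eq a r⁻¹).trans_le (hinv a hb)
  · exact (Real.dist_eq a' r⁻¹).trans_le (hinv a' hb')

/-- The sup metric dominates the distance between the `v` coordinates, and `v = 0` on `Diag₀`. -/
theorem dirSq_le_infDist_sq (q : StretchedProduct n) :
    dirSq q.1 ≤ Metric.infDist q (liftedDiagonal n) ^ 2 := by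
  obtain ⟨d, hd, -⟩ := exists_mem_liftedDiagonal_dist_le q
  refine pow_le_pow_left₀ (norm_nonneg _) ((Metric.le_infDist ⟨d, hd⟩).2 fun e he => ?_) 2
  have h0 : e.1.2.2.2.1 = 0 := by simpa [dirSq] using mem_liftedDiagonal_iff.1 he
  rw [← dist_zero_right, ← h0, Subtype.dist_eq]
  simp only [Prod.dist_eq, le_max_iff, le_refl, true_or, or_true]

theorem infDist_sq_le (q : StretchedProduct n) :
    Metric.infDist q (liftedDiagonal n) ^ 2 ≤ 225 * dirSq q.1 := by
  obtain ⟨d, hd, h⟩ := exists_mem_liftedDiagonal_dist_le q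
  refine (pow_le_pow_left₀ Metric.infDist_nonneg
    ((Metric.infDist_le_dist_of_mem hd).trans h) 2).trans ?_
  rw [mul_pow, Real.sq_sqrt (dirSq_nonneg _)]
  norm_num

/-! ### The distance function and its regular part -/

/-- A cutoff equal to `0` on `(-∞, 1/4]` and to `1` on `[3/8, ∞)`. -/
def cutoff (x : ℝ) : ℝ := Real.smoothTransition (8 * x - 2)

/-- A positive smooth function equal to `x` for `x ≥ 3/8` and to `1/100` for `x ≤ 1/4`. -/
def modifiedProd (x : ℝ) : ℝ := cutoff x * x + (1 - cutoff x) * (1 / 100)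

theorem contDiff_modifiedProd : ContDiff ℝ ∞ modifiedProd := by
  have h : ContDiff ℝ ∞ cutoff := Real.smoothTransition.contDiff.comp (by fun_prop)
  unfold modifiedProd
  fun_prop

theorem cutoff_nonneg (x : ℝ) : 0 ≤ cutoff x := Real.smoothTransition.nonneg _

theorem cutoff_le_one (x : ℝ) : cutoff x ≤ 1 := Real.smoothTransition.le_one _

theorem modifiedProd_of_le {x : ℝ} (hx : 3 / 8 ≤ x) : modifiedProd x = x := by
  have : cutoff x = 1 := Real.smoothTransition.one_of_one_le (by linarith)
  simp [modifiedProd, this]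

theorem modifiedProd_pos (x : ℝ) : 0 < modifiedProd x := by
  rcases le_total x (1 / 4) with h | h
  · have : cutoff x = 0 := Real.smoothTransition.zero_of_nonpos (by linarith)
    simp [modifiedProd, this]
  · unfold modifiedProd
    nlinarith [cutoff_nonneg x, cutoff_le_one x]

/-- The function `√|v|² + √(|v|² + a a')`. -/
def expHalf (x : StretchAmbient n) : ℝ :=
  Real.sqrt (dirSq x) + Real.sqrt (dirSq x + coordProd x)

theorem dirSq_add_coordProd_le_expHalf_sq (p : StretchedProduct n) :
    dirSq p.1 + coordProd p.1 ≤ expHalf p.1 ^ 2 := by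
  have h := Real.sq_sqrt (dirSq_add_coordProd_pos p).le
  unfold expHalf
  nlinarith [Real.sqrt_nonneg (dirSq p.1), Real.sqrt_nonneg (dirSq p.1 + coordProd p.1)]

/-- For `q ≤ 3/8`, `s ≥ (1 - 2q)/5` gives `s + q ≥ 1/5 > 1/100`; so `s + q` exceeds both `q` and
`1/100`, hence their convex combination `m(q)`. -/
theorem modifiedProd_lt_expHalf_sq {p : StretchedProduct n} (hp : 0 < dirSq p.1) :
    modifiedProd (coordProd p.1) < expHalf p.1 ^ 2 := by
  refine lt_of_lt_of_le ?_ (dirSq_add_coordProd_le_expHalf_sq p)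
  have h0 := coordProd_nonneg p
  rcases le_total (3 / 8) (coordProd p.1) with h | h
  · rw [modifiedProd_of_le h]; linarith
  · have h1 := le_coordProd p
    unfold modifiedProd
    nlinarith [cutoff_nonneg (coordProd p.1), cutoff_le_one (coordProd p.1)]

theorem contDiffAt_log_expHalf {x : StretchAmbient n} (hx : 0 < dirSq x)
    (hx' : 0 < dirSq x + coordProd x) :
    ContDiffAt ℝ ∞ (fun x : StretchAmbient n => Real.log (expHalf x)) x := by
  refine ContDiffAt.log ?_ (add_pos (Real.sqrt_pos.2 hx) (Real.sqrt_pos.2 hx')).ne'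
  exact (contDiff_dirSq.contDiffAt.sqrt hx.ne').add
    ((contDiff_dirSq.add contDiff_coordProd).contDiffAt.sqrt hx'.ne')

/-- The lifted distance, extended to the interior of the front face. -/
def extendedDist (x : StretchAmbient n) : ℝ := 2 * Real.log (expHalf x) - Real.log (coordProd x)

/-- The defining function of the left face. -/
def leftDefining (x : StretchAmbient n) : ℝ :=
  coordL x / Real.sqrt (modifiedProd (coordProd x))

/-- The regular part of the lifted distance. -/
def regularPart (x : StretchAmbient n) : ℝ :=
  2 * Real.log (expHalf x) - Real.log (modifiedProd (coordProd x))

theorem SmoothOn.of_contDiffAt {u : StretchedProduct n → ℝ} {S : Set (StretchedProduct n)}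
    (g : StretchAmbient n → ℝ) (hu : ∀ p, u p = g p.1) {U : Set (StretchAmbient n)}
    (hU : IsOpen U) (hS : ∀ p ∈ S, p.1 ∈ U) (hg : ∀ x ∈ U, ContDiffAt ℝ ∞ g x) :
    SmoothOn u S := fun p hp =>
  ⟨U, g, hU, hS p hp, fun x hx => (hg x hx).contDiffWithinAt, fun q _ _ => hu q⟩

theorem dirSq_pos_of_notMem {p : StretchedProduct n} (hp : p ∉ liftedDiagonal n) :
    0 < dirSq p.1 :=
  (dirSq_nonneg _).lt_of_ne' fun h => hp (mem_liftedDiagonal_iff.2 h)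

theorem contDiff_modifiedProd_coordProd :
    ContDiff ℝ ∞ (fun x : StretchAmbient n => modifiedProd (coordProd x)) :=
  contDiff_modifiedProd.comp contDiff_coordProd

theorem contDiff_leftDefining : ContDiff ℝ ∞ (leftDefining (n := n)) :=
  contDiff_coordL.div (contDiff_modifiedProd_coordProd.sqrt fun _ => (modifiedProd_pos _).ne')
    fun _ => (Real.sqrt_pos.2 (modifiedProd_pos _)).ne'

theorem contDiffAt_regularPart {x : StretchAmbient n} (hx : 0 < dirSq x)
    (hx' : 0 < dirSq x + coordProd x) : ContDiffAt ℝ ∞ regularPart x :=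
  (contDiffAt_const.mul (contDiffAt_log_expHalf hx hx')).sub
    (contDiff_modifiedProd_coordProd.contDiffAt.log (modifiedProd_pos _).ne')

theorem contDiffAt_extendedDist {x : StretchAmbient n} (hx : 0 < dirSq x)
    (hx' : 0 < coordProd x) : ContDiffAt ℝ ∞ extendedDist x :=
  (contDiffAt_const.mul (contDiffAt_log_expHalf hx (by positivity))).sub
    (contDiff_coordProd.contDiffAt.log hx'.ne')

theorem coordProd_pos {p : StretchedProduct n}
    (hp : p ∈ interiorPart n ∪ frontFaceInterior n) : 0 < coordProd p.1 :=
  mul_pos (coord_pos hp).1 (coord_pos hp).2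

theorem extendedDist_eq_arcosh (x : StretchAmbient n) (hx : 0 < coordProd x) :
    extendedDist x = Real.arcosh (1 + 2 * (dirSq x / coordProd x)) :=
  (arcosh_eq_log_sub_log (dirSq_nonneg x) hx).symm

theorem extendedDist_eq_hypDist {p : StretchedProduct n} (hp : p ∈ interiorPart n) :
    extendedDist p.1 = hypDist (blowDown p).1 (blowDown p).2 := by
  have hpos := coordProd_pos (Or.inl hp)
  rw [extendedDist_eq_arcosh _ hpos, hypDist]
  congr 2
  obtain ⟨⟨z, z', R, v, a, a'⟩, h1, h2, h3, h4, h5, h6, h7, h8⟩ := p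
  obtain ⟨hz, hz'⟩ := hp
  change ‖z‖ < 1 at hz
  change 0 < a * a' at hpos
  have hR : R ≠ 0 := by
    rintro rfl
    nlinarith [norm_nonneg z]
  change 2 * (‖v‖ ^ 2 / (a * a')) = 2 * ‖z - z'‖ ^ 2 / ((1 - ‖z‖ ^ 2) * (1 - ‖z'‖ ^ 2))
  rw [h1, h2, h3, norm_smul, mul_pow, Real.norm_eq_abs, sq_abs]
  have ha : a ≠ 0 := left_ne_zero_of_mul hpos.ne'
  have ha' : a' ≠ 0 := right_ne_zero_of_mul hpos.ne'
  field_simp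

theorem extendedDist_pos {p : StretchedProduct n} (hp : 0 < dirSq p.1)
    (hp' : 0 < coordProd p.1) : 0 < extendedDist p.1 := by
  rw [extendedDist_eq_arcosh _ hp']
  refine Real.arcosh_pos ?_
  have : 0 < dirSq p.1 / coordProd p.1 := by positivity
  linarith

theorem regularPart_pos {p : StretchedProduct n} (hp : 0 < dirSq p.1) :
    0 < regularPart p.1 := by
  have h := Real.log_lt_log (modifiedProd_pos _) (modifiedProd_lt_expHalf_sq hp)
  rw [Real.log_pow] at h
  unfold regularPart
  push_cast at h
  linarith

/-- Reflection fixes `q`, so the two factors `√m(q)` multiply to `m(q)` and `ρ_L ρ_R = q / m(q)`. -/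
theorem extendedDist_eq (p : StretchedProduct n) (hp : 0 < coordProd p.1) :
    extendedDist p.1 =
      -Real.log (leftDefining p.1 * leftDefining (reflect p).1) + regularPart p.1 := by
  have h : leftDefining p.1 * leftDefining (reflect p).1 =
      coordProd p.1 / modifiedProd (coordProd p.1) := by
    have h1 : coordProd (reflect p).1 = coordProd p.1 := mul_comm _ _
    rw [leftDefining, leftDefining, h1, coordL_reflect, div_mul_div_comm,
      Real.mul_self_sqrt (modifiedProd_pos _).le]
    rfl
  rw [h, Real.log_div hp.ne' (modifiedProd_pos _).ne', extendedDist, regularPart]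
  ring

theorem isDefiningFunction_leftDefining :
    IsDefiningFunction (fun p => leftDefining p.1) (leftFace n) := by
  have hne : ∀ x : ℝ, Real.sqrt (modifiedProd x) ≠ 0 := fun x =>
    (Real.sqrt_pos.2 (modifiedProd_pos x)).ne'
  refine ⟨.of_contDiffAt leftDefining (fun _ => rfl) isOpen_univ (fun _ _ => trivial)
    fun x _ => contDiff_leftDefining.contDiffAt, fun p => ?_, fun p => ?_, fun p hp => ?_⟩
  · exact div_nonneg (coordL_nonneg p) (Real.sqrt_nonneg _)
  · change leftDefining p.1 = 0 ↔ _
    rw [mem_leftFace_iff, leftDefining, div_eq_zero_iff, or_iff_left (hne _)]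
  · rw [mem_leftFace_iff] at hp
    have hR : 0 ≤ p.1.2.2.1 := p.2.2.2.2.2.2.1
    have hRt : ∀ t ∈ Set.Ico 0 (p.1.2.2.1 + 1)⁻¹, p.1.2.2.1 * t < 1 := by
      rintro t ⟨ht, ht'⟩
      rw [← one_div, lt_div_iff₀ (by positivity)] at ht'
      linarith
    classical
    -- Only `t` with `0 ≤ t < (R + 1)⁻¹` matter; there `Rt < 1` keeps the curve in the space, and
    -- the default `p` is never used.
    let γ : ℝ → StretchedProduct n := fun t =>
      if h : normalize (inwardCurve p.1 t) ∈ stretchedProductSet n then ⟨_, h⟩ else p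
    have hγ : ∀ t ∈ Set.Ico 0 (p.1.2.2.1 + 1)⁻¹, (γ t).1 = normalize (inwardCurve p.1 t) := by
      intro t ht
      have hm := normalize_inwardCurve_mem hp ht.1 (hRt t ht)
      simp only [γ, dif_pos hm]
    have hpos : 0 < (p.1.2.2.1 + 1)⁻¹ := by positivity
    have h0 : (0 : ℝ) ∈ Set.Ico 0 (p.1.2.2.1 + 1)⁻¹ := ⟨le_rfl, hpos⟩
    refine ⟨γ, (p.1.2.2.1 + 1)⁻¹, hpos, ?_, ?_, ?_⟩
    · apply Subtype.ext
      rw [hγ 0 h0, inwardCurve_zero hp, normalize_eq_self]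
    · refine ContDiffOn.congr (fun t ht => ?_) hγ
      exact ((contDiffAt_normalize (lengthSq_inwardCurve_pos hp ht.1 (hRt t ht))).comp t
        (contDiff_inwardCurve _).contDiffAt).contDiffWithinAt
    -- Along the curve `ρ_L = (2t - Rt²) φ(t)`, with one-sided derivative `2 φ(0) ≠ 0` at `0`.
    · let φ : ℝ → ℝ := fun t => (Real.sqrt (lengthSq (inwardCurve p.1 t)))⁻¹ /
        Real.sqrt (modifiedProd (coordProd (normalize (inwardCurve p.1 t))))
      have hφ : ∀ t ∈ Set.Ico 0 (p.1.2.2.1 + 1)⁻¹,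
          leftDefining (γ t).1 = (2 * t - p.1.2.2.1 * t ^ 2) * φ t := by
        intro t ht
        rw [hγ t ht, leftDefining, mul_div_assoc']
        congr 1
        exact mul_comm _ _
      have hN : 0 < lengthSq (inwardCurve p.1 0) := by
        rw [inwardCurve_zero hp, lengthSq_eq_one]; norm_num
      have hc : ContDiffAt ℝ ∞ (inwardCurve p.1) 0 := (contDiff_inwardCurve _).contDiffAt
      have hφd : DifferentiableAt ℝ φ 0 := by
        refine ContDiffAt.differentiableAt (n := ∞) (ContDiffAt.div ?_ ?_ (hne _)) (by simp)
        · exact ((contDiffAt_sqrt_lengthSq hN).comp 0 hc).inv (Real.sqrt_pos.2 hN).ne'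
        · exact (contDiff_modifiedProd_coordProd.contDiffAt.comp 0
            ((contDiffAt_normalize hN).comp 0 hc)).sqrt (modifiedProd_pos _).ne'
      have hpoly : HasDerivAt (fun t : ℝ => 2 * t - p.1.2.2.1 * t ^ 2) 2 0 := by
        have h := ((hasDerivAt_id (0 : ℝ)).const_mul 2).sub
          ((hasDerivAt_pow 2 (0 : ℝ)).const_mul p.1.2.2.1)
        exact h.congr_deriv (by simp)
      have hd := ((hpoly.mul hφd.hasDerivAt).hasDerivWithinAt
        (s := Set.Ico 0 (p.1.2.2.1 + 1)⁻¹)).congr hφ (hφ 0 h0)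
      rw [hd.derivWithin (uniqueDiffOn_Ico _ _ 0 h0)]
      have hφ0 : φ 0 ≠ 0 := div_ne_zero (inv_ne_zero (Real.sqrt_pos.2 hN).ne') (hne _)
      simpa using hφ0

/-! ### The regular part near the lifted diagonal -/

theorem regularPart_eq_arcosh {x : StretchAmbient n} (hx : 3 / 8 ≤ coordProd x) :
    regularPart x = Real.arcosh (1 + 2 * (dirSq x / coordProd x)) := by
  rw [← extendedDist_eq_arcosh _ (by linarith), regularPart, extendedDist, modifiedProd_of_le hx]

theorem exists_smooth_regularPart_sq {p : StretchedProduct n} (hp : dirSq p.1 = 0) :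
    ∃ (U : Set (StretchAmbient n)) (g : StretchAmbient n → ℝ), IsOpen U ∧ p.1 ∈ U ∧
      ContDiffOn ℝ ∞ g U ∧ ∀ q : StretchedProduct n, q.1 ∈ U → regularPart q.1 ^ 2 = g q.1 := by
  obtain ⟨G, hG, hGe⟩ := exists_analyticAt_eq_arcosh_sq
  obtain ⟨W, hW, hWo, hW0⟩ := eventually_nhds_iff.1 (hG.eventually_analyticAt.and hGe)
  have hV : IsOpen {x : StretchAmbient n | 3 / 8 < coordProd x} :=
    isOpen_lt continuous_const contDiff_coordProd.continuous
  have hc : ContDiffOn ℝ ∞ (fun x : StretchAmbient n => dirSq x / coordProd x)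
      {x | 3 / 8 < coordProd x} :=
    contDiff_dirSq.contDiffOn.div contDiff_coordProd.contDiffOn fun x hx =>
      (lt_trans (by norm_num) (show 3 / 8 < coordProd x from hx)).ne'
  refine ⟨_, fun x => G (dirSq x / coordProd x), hc.continuousOn.isOpen_inter_preimage hV hWo,
    ⟨?_, ?_⟩, ?_, ?_⟩
  · have := le_coordProd p
    rw [hp] at this
    exact lt_of_lt_of_le (by norm_num) this
  · simpa [hp] using hW0
  · intro x hx
    exact ((hW _ hx.2).1.contDiffAt.comp_contDiffWithinAt x (hc x hx.1)).mono
      Set.inter_subset_left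
  · rintro q ⟨hq, hq'⟩
    rw [regularPart_eq_arcosh (le_of_lt hq)]
    exact (hW _ hq').2 (div_nonneg (dirSq_nonneg _) (coordProd_nonneg q))

theorem smoothOn_extendedDist :
    SmoothOn (fun p : StretchedProduct n => extendedDist p.1)
      ((interiorPart n ∪ frontFaceInterior n) \ liftedDiagonal n) :=
  .of_contDiffAt extendedDist (fun _ => rfl) (U := {x | 0 < dirSq x ∧ 0 < coordProd x})
    ((isOpen_lt continuous_const contDiff_dirSq.continuous).inter
      (isOpen_lt continuous_const contDiff_coordProd.continuous))
    (fun _ hp => ⟨dirSq_pos_of_notMem hp.2, coordProd_pos hp.1⟩)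
    fun _ hx => contDiffAt_extendedDist hx.1 hx.2

theorem smoothOn_regularPart :
    SmoothOn (fun p : StretchedProduct n => regularPart p.1) (liftedDiagonal n)ᶜ :=
  .of_contDiffAt regularPart (fun _ => rfl) (U := {x | 0 < dirSq x ∧ 0 < dirSq x + coordProd x})
    ((isOpen_lt continuous_const contDiff_dirSq.continuous).inter
      (isOpen_lt continuous_const (contDiff_dirSq.add contDiff_coordProd).continuous))
    (fun p hp => ⟨dirSq_pos_of_notMem hp, dirSq_add_coordProd_pos p⟩)
    fun _ hx => contDiffAt_regularPart hx.1 hx.2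

theorem smoothOn_regularPart_sq :
    SmoothOn (fun p : StretchedProduct n => regularPart p.1 ^ 2) Set.univ := by
  intro p _
  rcases (dirSq_nonneg p.1).eq_or_lt with h | h
  · obtain ⟨U, g, hU, hp, hg, hq⟩ := exists_smooth_regularPart_sq h.symm
    exact ⟨U, g, hU, hp, hg, fun q _ => hq q⟩
  · refine ⟨{x | 0 < dirSq x ∧ 0 < dirSq x + coordProd x}, fun x => regularPart x ^ 2,
      (isOpen_lt continuous_const contDiff_dirSq.continuous).inter
      (isOpen_lt continuous_const (contDiff_dirSq.add contDiff_coordProd).continuous),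
      ⟨h, dirSq_add_coordProd_pos p⟩, fun x hx =>
        ((contDiffAt_regularPart hx.1 hx.2).pow 2).contDiffWithinAt, fun _ _ _ => rfl⟩

theorem regularPart_eq_zero {p : StretchedProduct n} (hp : dirSq p.1 = 0) :
    regularPart p.1 = 0 := by
  have h := le_coordProd p
  rw [regularPart_eq_arcosh (by rw [hp] at h; linarith), hp]
  simp

/-- `q ≥ 2/5` forces `s ≤ 1 - 2q ≤ 1/5`, so `s/q ≤ 1/2`, the range of `le_arcosh_sq`. As `2/5 ≤ q ≤
1/2`, `s/q` is comparable to `s`. -/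
theorem regularPart_sq_bounds {q : StretchedProduct n} (hq : 2 / 5 ≤ coordProd q.1) :
    2 * dirSq q.1 ≤ regularPart q.1 ^ 2 ∧ regularPart q.1 ^ 2 ≤ 16 * dirSq q.1 := by
  have h1 := coordProd_le q
  have hs := dirSq_nonneg q.1
  have hpos : 0 < coordProd q.1 := by linarith
  rw [regularPart_eq_arcosh (by linarith)]
  set x := dirSq q.1 / coordProd q.1 with hx
  have hx0 : 0 ≤ x := by positivity
  have hsx : dirSq q.1 = x * coordProd q.1 := by rw [hx, div_mul_cancel₀ _ hpos.ne']
  have hlow := le_arcosh_sq hx0 (by rw [hx, div_le_iff₀ hpos]; linarith)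
  have hup := arcosh_sq_le hx0
  constructor <;> nlinarith

theorem isQuadraticDefiningFunction_regularPart_sq :
    IsQuadraticDefiningFunction (fun p => regularPart p.1 ^ 2) (liftedDiagonal n) := by
  refine ⟨smoothOn_regularPart_sq, fun p => sq_nonneg _, fun p => ?_, fun p hp => ?_⟩
  · change regularPart p.1 ^ 2 = 0 ↔ _
    rw [mem_liftedDiagonal_iff, sq_eq_zero_iff]
    refine ⟨fun h => ?_, regularPart_eq_zero⟩
    by_contra h0
    exact (regularPart_pos ((dirSq_nonneg _).lt_of_ne' h0)).ne' h
  -- From `2s ≤ F² ≤ 16s` and `s ≤ dist² ≤ 225s`, valid near `Diag₀`, where `q` is close to `1/2 >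
  -- 2/5`.
  · refine ⟨2 / 225, 16, by norm_num, by norm_num, ?_⟩
    have hlt : 2 / 5 < coordProd p.1 := by
      have h := le_coordProd p
      rw [mem_liftedDiagonal_iff.1 hp] at h
      linarith
    have hc : Continuous fun q : StretchedProduct n => coordProd q.1 :=
      contDiff_coordProd.continuous.comp continuous_subtype_val
    filter_upwards [hc.continuousAt.eventually (lt_mem_nhds hlt)] with q hq
    have h := regularPart_sq_bounds hq.le
    have h1 := dirSq_le_infDist_sq q
    have h2 := infDist_sq_le q
    constructor <;> linarith

end StretchedProduct

end

/-! ### The structure theorem for the lifted distance -/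

theorem mainTheorem8 (n : ℕ) :
    ∃ D : StretchedProduct n → ℝ,
      -- `D` extends the lifted hyperbolic distance from the interior
      (∀ p ∈ StretchedProduct.interiorPart n,
        D p = hypDist (StretchedProduct.blowDown p).1 (StretchedProduct.blowDown p).2) ∧
      -- smoothly up to the interior of the front face away from the lifted diagonal,
      -- and it is positive there
      StretchedProduct.SmoothOn D
        ((StretchedProduct.interiorPart n ∪ StretchedProduct.frontFaceInterior n) \
          StretchedProduct.liftedDiagonal n) ∧
      (∀ p ∈ (StretchedProduct.interiorPart n ∪ StretchedProduct.frontFaceInterior n) \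
          StretchedProduct.liftedDiagonal n, 0 < D p) ∧
      -- with the stated form
      ∃ ρL ρR F : StretchedProduct n → ℝ,
        StretchedProduct.IsDefiningFunction ρL (StretchedProduct.leftFace n) ∧
        (∀ p, ρR p = ρL (StretchedProduct.reflect p)) ∧
        (∀ p ∈ StretchedProduct.interiorPart n ∪ StretchedProduct.frontFaceInterior n,
          D p = -Real.log (ρL p * ρR p) + F p) ∧
        (∀ p ∈ (StretchedProduct.liftedDiagonal n)ᶜ, 0 < F p) ∧
        StretchedProduct.SmoothOn F (StretchedProduct.liftedDiagonal n)ᶜ ∧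
        StretchedProduct.SmoothOn (fun p => F p ^ 2) Set.univ ∧
        StretchedProduct.IsQuadraticDefiningFunction (fun p => F p ^ 2)
          (StretchedProduct.liftedDiagonal n) := by
  refine ⟨fun p => StretchedProduct.extendedDist p.1,
    fun _ hp => StretchedProduct.extendedDist_eq_hypDist hp,
    StretchedProduct.smoothOn_extendedDist,
    fun _ hp => StretchedProduct.extendedDist_pos (StretchedProduct.dirSq_pos_of_notMem hp.2)
      (StretchedProduct.coordProd_pos hp.1),
    fun p => StretchedProduct.leftDefining p.1,
    fun p => StretchedProduct.leftDefining (StretchedProduct.reflect p).1,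
    fun p => StretchedProduct.regularPart p.1,
    StretchedProduct.isDefiningFunction_leftDefining, fun _ => rfl,
    fun p hp => StretchedProduct.extendedDist_eq p (StretchedProduct.coordProd_pos hp),
    fun _ hp => StretchedProduct.regularPart_pos (StretchedProduct.dirSq_pos_of_notMem hp),
    StretchedProduct.smoothOn_regularPart, StretchedProduct.smoothOn_regularPart_sq,
    StretchedProduct.isQuadraticDefiningFunction_regularPart_sq⟩
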